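/- Let $n\ge 2$ and $t\ge 1$ be integers. A finite nonempty subset $X$ of the unit sphere $S^{n-1}\subset\mathbb{R}^n$ is called a harmonic index $t$-design if $\sum_{x\in X}f(x)=0$ for every real homogeneous polynomial $f$ of degree $t$ in $n$ variables with $\Delta f=\sum_{i=1}^n\partial^2 f/\partial x_i^2=0$. Let $I(X)=\{\langle x,y\rangle : x,y\in X,\ x\neq y\}$. For real $\lambda\neq 0$ let $C_t^{\lambda}(x)$ be the Gegenbauer polynomial defined by $(1-2xr+r^2)^{-\lambda}=\sum_{t\ge 0}C_t^{\lambda}(x)r^t$, and let $C_t^{0}=T_t$ be the Chebyshev polynomial of the first kind. Let $Q_{n,t}=A_{n,t}\,C_t^{(n-2)/2}$, where the constant $A_{n,t}$ is chosen so that $$Q_{n,t}(1)=\binom{n+t-1}{t}-\binom{n+t-3}{t-2},$$ where $\binom{a}{b}=0$ for $b<0$. Let $X$ be a harmonic index $t$-design on $S^{n-1}$ and put $c_{n,t}=-\min_{-1\le x\le 1}Q_{n,t}(x)$ (the minimum exists, and $c_{n,t}>0$). Then $$|X|\ \ge\ 1+\frac{1}{c_{n,t}}\left\{\binom{n+t-1}{t}-\binom{n+t-3}{t-2}\right\}.$$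 Moreover, equality holds if and only if $c_{n,t}=-Q_{n,t}(a)$ for every $a\in I(X)$. -/

import Mathlib

noncomputable section

namespace HarmonicIndex

/-- The Laplacian of a real polynomial in `n` variables. -/
def laplacian {n : ℕ} (f : MvPolynomial (Fin n) ℝ) : MvPolynomial (Fin n) ℝ :=
  ∑ i, MvPolynomial.pderiv i (MvPolynomial.pderiv i f)

/-- `f` belongs to the space of harmonic homogeneous polynomials of degree `t` on `ℝⁿ`. -/
def IsHarm {n : ℕ} (t : ℕ) (f : MvPolynomial (Fin n) ℝ) : Prop :=
  f.IsHomogeneous t ∧ laplacian f = 0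

/-- `X` is a spherical design of harmonic index `t` on the unit sphere of `ℝⁿ`. -/
structure IsDesign {n : ℕ} (t : ℕ) (X : Finset (EuclideanSpace ℝ (Fin n))) : Prop where
  nonempty : X.Nonempty
  subset_sphere : ∀ x ∈ X, x ∈ Metric.sphere (0 : EuclideanSpace ℝ (Fin n)) 1
  sum_eq_zero : ∀ f : MvPolynomial (Fin n) ℝ, IsHarm t f →
    ∑ x ∈ X, MvPolynomial.eval (fun i => x i) f = 0

/-- The set of inner products of distinct points of `X`. -/
def innerProducts {n : ℕ} (X : Finset (EuclideanSpace ℝ (Fin n))) : Set ℝ :=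
  {a | ∃ x ∈ X, ∃ y ∈ X, x ≠ y ∧ a = inner ℝ x y}

/-- The value `C_t^l(x)` of the Gegenbauer polynomial: for `l ≠ 0` the coefficient of `r ^ t` in
the power series `(1 - 2 x r + r ^ 2) ^ (-l)` in `r` (the binomial series `(1 + z) ^ (-l)` at
`z = r ^ 2 - 2 x r`); for `l = 0` the Chebyshev polynomial of the first kind `T_t(x)`. -/
def gegenbauer (l : ℝ) (t : ℕ) (x : ℝ) : ℝ :=
  if l = 0 then (Polynomial.Chebyshev.T ℝ t).eval x
  else PowerSeries.coeff t
    ((PowerSeries.binomialSeries ℝ (-l)).subst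
      ((PowerSeries.X : PowerSeries ℝ) ^ 2 - PowerSeries.C (2 * x) * PowerSeries.X))

/-- The binomial coefficient `a choose b` with integer entries, zero for `b < 0`. -/
def binom (a b : ℤ) : ℤ :=
  if b < 0 then 0 else Ring.choose a b.toNat

/-- `(n+t-1 choose t) - (n+t-3 choose t-2)`. -/
def dimHarm (n t : ℕ) : ℝ :=
  (binom ((n : ℤ) + t - 1) t : ℝ) - (binom ((n : ℤ) + t - 3) ((t : ℤ) - 2) : ℝ)

/-- The multiple of the Gegenbauer polynomial of degree `t` and parameter `(n-2)/2`
that takes the value `dimHarm n t` at `1`. -/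
def Q (n t : ℕ) (x : ℝ) : ℝ :=
  dimHarm n t / gegenbauer (((n : ℝ) - 2) / 2) t 1 * gegenbauer (((n : ℝ) - 2) / 2) t x

/-- Minus the minimum of `Q n t` on `[-1, 1]`. -/
def c (n t : ℕ) : ℝ :=
  -sInf (Q n t '' Set.Icc (-1) 1)

end HarmonicIndex

end

/-!
For a fixed unit vector `y`, the function `x ↦ Q n t ⟨x, y⟩` on the unit sphere is the restriction
of a harmonic form of degree `t`, the zonal harmonic with pole `y` (`isHarm_zonal`, `eval_zonal`,
`Q_eq`). Hence for a design `X` of harmonic index `t` and `y ∈ X`,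
`∑ x ∈ X, Q n t ⟨x, y⟩ = 0`. The term `x = y` is `Q n t 1 = dimHarm n t`, so the remaining
`|X| - 1` terms sum to `-dimHarm n t` (`IsDesign.sum_erase`). Each of them is at least `-c n t`, so
`c n t * (|X| - 1) - dimHarm n t` is the sum over `x ≠ y` of the nonnegative numbers
`Q n t ⟨x, y⟩ + c n t`. This is the bound, and equality means that all these numbers vanish, for
one `y ∈ X` or equivalently for every `y ∈ X`. Positivity of `c n t` is read off from the same sum.

Harmonicity is proved from a three-term recurrence. Dividing the Gegenbauer polynomial with
parameter `(n - 2) / 2` by its value at `1` and homogenising with `s = ‖x‖ ^ 2` gives polynomials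
`Z_t` in `u = ⟨x, y⟩` and `s` with
`(m + n - 1) Z_{m+2} = (2 m + n) u Z_{m+1} - (m + 1) s Z_m`,
a form that remains valid for `n = 2`, where it defines the Chebyshev polynomials. By induction the
derivative of `Z_{t+1}` in the direction `y` is `(t + 1) Z_t` (`derivation_zonal`); with Euler's
identity, the product rules for the Laplacian against `u` and `s` then turn the recurrence into
`Δ Z_t = 0` (`laplace_zonal`). The recurrence for the Gegenbauer polynomials themselves comes from
the differential equation of their generating function (`gegenbauer_recurrence`).
-/

noncomputable section

namespace HarmonicIndex

open MvPolynomial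

/-- The homogenised Gegenbauer polynomials in dimension `n`, normalised to take the value `1` at
`u = s = 1`. For `u = ⟨x, y⟩` and `s = ‖x‖ ^ 2` these are the zonal harmonics with pole `y`; for
`s = 1` they are the one-variable Gegenbauer polynomials. With this normalisation a single
recurrence covers all `n ≥ 2`, the Chebyshev case `n = 2` included. -/
def zonal {A : Type*} [CommRing A] [Algebra ℝ A] (n : ℕ) (u s : A) : ℕ → A
  | 0 => 1
  | 1 => u
  | m + 2 => ((m : ℝ) + n - 1)⁻¹ •
      ((2 * (m : A) + n) * u * zonal n u s (m + 1) - ((m : A) + 1) * s * zonal n u s m)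

/-! ### The recurrence in a general algebra -/

section Algebra

variable {A : Type*} [CommRing A] [Algebra ℝ A] {n : ℕ}

lemma recurrence_coeff_pos (hn : 2 ≤ n) (m : ℕ) : 0 < (m : ℝ) + n - 1 := by
  have : (2 : ℝ) ≤ n := by exact_mod_cast hn
  have : (0 : ℝ) ≤ m := m.cast_nonneg
  linarith

lemma zonal_recurrence (hn : 2 ≤ n) (u s : A) (m : ℕ) :
    ((m : A) + n - 1) * zonal n u s (m + 2) =
      (2 * (m : A) + n) * u * zonal n u s (m + 1) - ((m : A) + 1) * s * zonal n u s m := by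
  have h : ((m : A) + n - 1) = algebraMap ℝ A ((m : ℝ) + n - 1) := by simp
  rw [zonal, h, ← Algebra.smul_def, smul_inv_smul₀ (recurrence_coeff_pos hn m).ne']

lemma recurrence_coeff_cancel (hn : 2 ≤ n) (m : ℕ) {a b : A}
    (h : ((m : A) + n - 1) * a = ((m : A) + n - 1) * b) : a = b := by
  have h' : ((m : A) + n - 1) = algebraMap ℝ A ((m : ℝ) + n - 1) := by simp
  rw [h', ← Algebra.smul_def, ← Algebra.smul_def] at h
  exact smul_right_injective A (recurrence_coeff_pos hn m).ne' h

lemma map_zonal {B : Type*} [CommRing B] [Algebra ℝ B] (f : A →ₐ[ℝ] B) (u s : A) (t : ℕ) :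
    f (zonal n u s t) = zonal n (f u) (f s) t := by
  induction t using Nat.twoStepInduction with
  | zero => simp [zonal]
  | one => simp [zonal]
  | more m h0 h1 => simp [zonal, h0, h1, map_ofNat f 2]

/-- The zonal polynomials form an Appell sequence for differentiation in the direction of the
pole. -/
lemma derivation_zonal (hn : 2 ≤ n) {u s : A} (D : Derivation ℝ A A) (hu : D u = 1)
    (hs : D s = 2 * u) (t : ℕ) : D (zonal n u s (t + 1)) = ((t : A) + 1) * zonal n u s t := by
  -- One step of the induction; it needs the claim for the two preceding indices.
  have key : ∀ m, D (zonal n u s (m + 1)) = ((m : A) + 1) * zonal n u s m →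
      D (zonal n u s m) = (m : A) * zonal n u s (m - 1) →
      D (zonal n u s (m + 2)) = ((m : A) + 2) * zonal n u s (m + 1) := by
    intro m h1 h0
    apply recurrence_coeff_cancel hn m
    have h := congrArg D (zonal_recurrence hn u s m)
    have hc : D ((m : A) + n - 1) = 0 := by simp
    have hc' : D (2 * (m : A) + n) = 0 := by
      simpa using D.map_natCast (2 * m + n)
    have hc'' : D ((m : A) + 1) = 0 := by simp
    simp only [Derivation.leibniz, map_sub, smul_eq_mul, hu, hs, h1] at h
    simp only [← map_sub, hc, hc', hc''] at h
    rcases m with _ | k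
    · simp [zonal] at h h0 ⊢
      linear_combination h 
    · have hr := zonal_recurrence hn u s k
      simp only [Nat.add_sub_cancel] at h0
      rw [show k + 1 + 2 = k + 3 from rfl, show k + 1 + 1 = k + 2 from rfl] at *
      push_cast at *
      linear_combination h - ((k : A) + 2) * s * h0 - ((k : A) + 2) * hr
  have main : ∀ t, D (zonal n u s (t + 1)) = ((t : A) + 1) * zonal n u s t ∧
      D (zonal n u s t) = (t : A) * zonal n u s (t - 1) := by
    intro t
    induction t with
    | zero => simp [zonal, hu]
    | succ m ih =>
      have h2 := key m ih.1 ih.2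
      refine ⟨?_, by simpa using ih.1⟩
      rw [h2]; push_cast; ring
  exact (main t).1

/-- A Laplace-type operator, given by its product rules against `u` and `s`, kills the zonal
polynomials. -/
lemma laplace_zonal (hn : 2 ≤ n) {u s : A} (D : Derivation ℝ A A) (hu : D u = 1)
    (hs : D s = 2 * u) (L : A →ₗ[ℝ] A) (hL1 : L 1 = 0)
    (hLu : ∀ z, L (u * z) = u * L z + 2 * D z)
    (hLs : ∀ m, L (s * zonal n u s m) =
      s * L (zonal n u s m) + (4 * (m : A) + 2 * n) * zonal n u s m) (t : ℕ) :
    L (zonal n u s t) = 0 := by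
  have hL (r : ℝ) (z : A) : L (algebraMap ℝ A r * z) = algebraMap ℝ A r * L z := by
    rw [← Algebra.smul_def, map_smul, Algebra.smul_def]
  induction t using Nat.twoStepInduction with
  | zero => simp [zonal, hL1]
  | one => simpa [zonal, hL1] using hLu 1
  | more m h0 h1 =>
    apply recurrence_coeff_cancel hn m
    have h := congrArg L (zonal_recurrence hn u s m)
    have e1 := hL ((m : ℝ) + n - 1) (zonal n u s (m + 2))
    have e2 := hL (2 * (m : ℝ) + n) (u * zonal n u s (m + 1))
    have e3 := hL ((m : ℝ) + 1) (s * zonal n u s m)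
    simp only [map_sub, map_add, map_mul, map_natCast, map_one, map_ofNat] at e1 e2 e3
    rw [map_sub, mul_assoc _ u, mul_assoc _ s] at h
    rw [e1, e2, e3, hLu, hLs, h0, h1, derivation_zonal hn D hu hs] at h
    linear_combination h

end Algebra

/-! ### Zonal harmonics as polynomials in several variables -/

section ZonalHarmonic

variable {n : ℕ}

/-- The linear form `x ↦ ⟨x, y⟩` as a polynomial. -/
def linForm (y : Fin n → ℝ) : MvPolynomial (Fin n) ℝ := ∑ i, C (y i) * X i

/-- The quadratic form `x ↦ ‖x‖ ^ 2` as a polynomial. -/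
def normSq (n : ℕ) : MvPolynomial (Fin n) ℝ := ∑ i, X i ^ 2

/-- The derivative in the direction `y`, on polynomials. -/
def dirDeriv (y : Fin n → ℝ) :
    Derivation ℝ (MvPolynomial (Fin n) ℝ) (MvPolynomial (Fin n) ℝ) := ∑ i, y i • pderiv i

lemma dirDeriv_apply (y : Fin n → ℝ) (p : MvPolynomial (Fin n) ℝ) :
    dirDeriv y p = ∑ i, C (y i) * pderiv i p := by
  rw [dirDeriv, ← Derivation.coeFnAddMonoidHom_apply, map_sum]
  simp [Derivation.coeFnAddMonoidHom_apply, MvPolynomial.smul_eq_C_mul]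

lemma pderiv_linForm (y : Fin n → ℝ) (i : Fin n) : pderiv i (linForm y) = C (y i) := by
  simp [linForm, pderiv_X, Pi.single_apply]

lemma pderiv_normSq (i : Fin n) : pderiv i (normSq n) = 2 * X i := by
  simp [normSq, pderiv_X, Pi.single_apply, Derivation.leibniz_pow, two_mul]

lemma laplacian_mul (p q : MvPolynomial (Fin n) ℝ) :
    laplacian (p * q) =
      p * laplacian q + q * laplacian p + 2 * ∑ i, pderiv i p * pderiv i q := by
  simp only [laplacian, Finset.mul_sum, ← Finset.sum_add_distrib]
  refine Finset.sum_congr rfl fun i _ => ?_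
  simp only [Derivation.leibniz, map_add, smul_eq_mul]
  ring

lemma laplacian_linForm_mul (y : Fin n → ℝ) (q : MvPolynomial (Fin n) ℝ) :
    laplacian (linForm y * q) = linForm y * laplacian q + 2 * dirDeriv y q := by
  have h : laplacian (linForm y) = 0 := by simp [laplacian, pderiv_linForm]
  simp [laplacian_mul, h, pderiv_linForm, dirDeriv_apply]

/-- The cross term of the product rule is evaluated by Euler's identity. -/
lemma laplacian_normSq_mul {q : MvPolynomial (Fin n) ℝ} {m : ℕ} (hq : q.IsHomogeneous m) :
    laplacian (normSq n * q) =
      normSq n * laplacian q + (4 * (m : MvPolynomial (Fin n) ℝ) + 2 * n) * q := by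
  have h : laplacian (normSq n) = 2 * n := by
    have h2 (i : Fin n) : pderiv i (2 : MvPolynomial (Fin n) ℝ) = 0 := by
      simpa using (pderiv i : Derivation ℝ (MvPolynomial (Fin n) ℝ) _).map_natCast 2
    simp [laplacian, pderiv_normSq, h2, mul_comm]
  have e := hq.sum_X_mul_pderiv
  rw [nsmul_eq_mul] at e
  simp only [laplacian_mul, h, pderiv_normSq, mul_assoc, ← Finset.mul_sum, e]
  ring

lemma isHomogeneous_zonal (y : Fin n → ℝ) (t : ℕ) :
    (zonal n (linForm y) (normSq n) t).IsHomogeneous t := by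
  have hu : (linForm y).IsHomogeneous 1 :=
    IsHomogeneous.sum _ _ _ fun i _ => isHomogeneous_C_mul_X _ _
  have hs : (normSq n).IsHomogeneous 2 :=
    IsHomogeneous.sum _ _ _ fun i _ => isHomogeneous_X_pow _ _
  have hc (r : ℝ) {k : ℕ} {p : MvPolynomial (Fin n) ℝ} (hp : p.IsHomogeneous k) :
      (C r * p).IsHomogeneous k := hp.C_mul r
  induction t using Nat.twoStepInduction with
  | zero => exact isHomogeneous_one _ _
  | one => exact hu
  | more m h0 h1 =>
    have e1 := hc (2 * (m : ℝ) + n) (hu.mul h1)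
    have e2 := hc ((m : ℝ) + 1) (hs.mul h0)
    rw [show 1 + (m + 1) = m + 2 by ring] at e1
    rw [show 2 + m = m + 2 by ring] at e2
    have := hc ((m : ℝ) + n - 1)⁻¹ (e1.sub e2)
    have h2 : (C 2 : MvPolynomial (Fin n) ℝ) = 2 := map_ofNat C 2
    simpa [zonal, MvPolynomial.smul_eq_C_mul, mul_assoc, h2] using this

/-- The zonal polynomial with a pole on the unit sphere is a harmonic form. -/
lemma isHarm_zonal (hn : 2 ≤ n) {y : Fin n → ℝ} (hy : ∑ i, y i ^ 2 = 1) (t : ℕ) :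
    IsHarm t (zonal n (linForm y) (normSq n) t) := by
  refine ⟨isHomogeneous_zonal y t, ?_⟩
  let L : MvPolynomial (Fin n) ℝ →ₗ[ℝ] MvPolynomial (Fin n) ℝ :=
    ∑ i, (pderiv i).toLinearMap ∘ₗ (pderiv i).toLinearMap
  have hL (p) : L p = laplacian p := by simp [L, laplacian]
  rw [← hL]
  refine laplace_zonal hn (dirDeriv y) ?_ ?_ L ?_ ?_ ?_ t
  · simp only [dirDeriv_apply, pderiv_linForm, ← sq, ← map_pow]
    rw [← map_sum, hy, map_one]
  · simp only [dirDeriv_apply, pderiv_normSq, linForm, Finset.mul_sum]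
    exact Finset.sum_congr rfl fun i _ => by ring
  · simp [hL, laplacian]
  · intro z
    rw [hL, hL, laplacian_linForm_mul]
  · intro m
    rw [hL, hL, laplacian_normSq_mul (isHomogeneous_zonal y m)]

lemma eval_zonal {x y : EuclideanSpace ℝ (Fin n)} (hx : ‖x‖ = 1) (t : ℕ) :
    eval (fun i => x i) (zonal n (linForm fun i => y i) (normSq n) t) =
      zonal n (inner ℝ x y) 1 t := by
  have h := map_zonal (n := n) (aeval fun i => x i) (linForm fun i => y i) (normSq n) t
  have e1 : aeval (fun i => x i) (linForm fun i => y i) = (inner ℝ x y : ℝ) := by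
    simp [linForm, PiLp.inner_apply]
  have e2 : aeval (fun i => x i) (normSq n) = (1 : ℝ) := by
    have := EuclideanSpace.real_norm_sq_eq x
    simpa [normSq, hx] using this.symm
  rw [e1, e2] at h
  rw [← h, aeval_eq_eval]

end ZonalHarmonic

/-! ### Comparison with the Gegenbauer polynomials -/

section Gegenbauer

lemma zonal_one_one {n : ℕ} (hn : 2 ≤ n) (t : ℕ) : zonal n (1 : ℝ) 1 t = 1 := by
  induction t using Nat.twoStepInduction with
  | zero => rfl
  | one => rfl
  | more m h0 h1 =>
    apply recurrence_coeff_cancel hn m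
    rw [zonal_recurrence hn, h0, h1]
    ring

lemma continuous_zonal (n t : ℕ) : Continuous fun x : ℝ => zonal n x 1 t := by
  induction t using Nat.twoStepInduction with
  | zero => exact continuous_const
  | one => exact continuous_id
  | more m h0 h1 =>
    simp only [zonal]
    fun_prop

lemma chebyshev_eq_zonal (x : ℝ) (t : ℕ) :
    (Polynomial.Chebyshev.T ℝ t).eval x = zonal 2 x 1 t := by
  induction t using Nat.twoStepInduction with
  | zero => simp [zonal]
  | one => simp [zonal]
  | more m h0 h1 =>
    apply recurrence_coeff_cancel le_rfl m
    rw [zonal_recurrence le_rfl, ← h0, ← h1]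
    push_cast
    rw [Polynomial.Chebyshev.T_add_two]
    simp
    ring

open PowerSeries in
/-- The differential equation `(1 + z) B' = a B` of the binomial series `B = (1 + z) ^ a`. -/
lemma derivative_binomialSeries (a : ℝ) :
    (1 + PowerSeries.X) * PowerSeries.derivative ℝ (PowerSeries.binomialSeries ℝ a) =
      PowerSeries.C a * PowerSeries.binomialSeries ℝ a := by
  have hc (k : ℕ) : Ring.choose a (k + 1) * (k + 1) = (a - k) * Ring.choose a k := by
    have := (Nat.cast_ne_zero (R := ℝ)).2 k.factorial_ne_zero
    have h1 : (k : ℝ) + 1 ≠ 0 := by positivity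
    simp only [Ring.choose_eq_smul, descPochhammer_succ_right, Polynomial.smeval_mul,
      Nat.factorial_succ, smul_eq_mul, Polynomial.smeval_sub, Polynomial.smeval_X,
      Polynomial.smeval_natCast]
    push_cast
    field_simp
    simp
  ext k
  rw [add_mul, one_mul, map_add, coeff_derivative, PowerSeries.coeff_C_mul]
  rcases k with _ | k
  · simp
  · have h := hc (k + 1)
    rw [coeff_succ_X_mul, coeff_derivative]
    simp at h ⊢
    linarith

/-- The three-term recurrence of the Gegenbauer polynomials, read off from the differential
equation `(1 - 2 x r + r ^ 2) F' = 2 l (x - r) F` of their generating function. -/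
lemma gegenbauer_recurrence {l : ℝ} (hl : l ≠ 0) (x : ℝ) :
    gegenbauer l 0 x = 1 ∧ gegenbauer l 1 x = 2 * l * x ∧
    ∀ m : ℕ, ((m : ℝ) + 2) * gegenbauer l (m + 2) x =
      2 * (m + 1 + l) * x * gegenbauer l (m + 1) x - (m + 2 * l) * gegenbauer l m x := by
  set w : PowerSeries ℝ :=
    (PowerSeries.X : PowerSeries ℝ) ^ 2 - PowerSeries.C (2 * x) * PowerSeries.X with hw
  set F : PowerSeries ℝ := (PowerSeries.binomialSeries ℝ (-l)).subst w with hF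
  have hg (t : ℕ) : gegenbauer l t x = PowerSeries.coeff t F := by simp [gegenbauer, hl, hF, hw]
  have hw0 : PowerSeries.constantCoeff w = 0 := by simp [hw]
  have hs : PowerSeries.HasSubst w := PowerSeries.HasSubst.of_constantCoeff_zero' hw0
  have hF0 : PowerSeries.coeff 0 F = 1 := by
    have h : PowerSeries.constantCoeff
        ((PowerSeries.binomialSeries ℝ (-l) - PowerSeries.C 1).subst w) = 0 :=
      PowerSeries.constantCoeff_subst_eq_zero hw0 _ (by simp)
    rw [PowerSeries.subst_sub hs, PowerSeries.subst_C, map_sub] at h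
    rw [PowerSeries.coeff_zero_eq_constantCoeff_apply, hF, sub_eq_zero.1 h]
    simp
  have hode : (1 + w) * PowerSeries.derivative ℝ F =
      PowerSeries.C (-l) * F * PowerSeries.derivative ℝ w := by
    have h := congrArg (fun f : PowerSeries ℝ => f.subst w) (derivative_binomialSeries (-l))
    have h1 : PowerSeries.subst w (1 : PowerSeries ℝ) = (1 : PowerSeries ℝ) := by
      rw [← map_one PowerSeries.C, PowerSeries.subst_C]; rfl
    have h2 : PowerSeries.subst w (PowerSeries.C (-l)) = PowerSeries.C (-l) := by
      rw [PowerSeries.subst_C]; rfl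
    simp only [PowerSeries.subst_mul hs, PowerSeries.subst_add hs, PowerSeries.subst_X hs,
      h1, h2] at h
    rw [hF, PowerSeries.derivative_subst hs, ← mul_assoc, h]
  have hdw : PowerSeries.derivative ℝ w = 2 * PowerSeries.X - PowerSeries.C (2 * x) := by
    simp [hw]
  rw [hdw] at hode
  have hode' : PowerSeries.derivative ℝ F
      + PowerSeries.X * (PowerSeries.X * PowerSeries.derivative ℝ F)
      - PowerSeries.C (2 * x) * (PowerSeries.X * PowerSeries.derivative ℝ F) =
      PowerSeries.C (2 * l * x) * F - PowerSeries.C (2 * l) * (PowerSeries.X * F) := by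
    rw [hw] at hode
    simp only [map_mul, map_neg, map_ofNat] at hode ⊢
    linear_combination hode
  have hcoeff (k : ℕ) := congrArg (PowerSeries.coeff k) hode'
  simp only [map_add, map_sub, PowerSeries.coeff_C_mul, PowerSeries.coeff_derivative] at hcoeff
  simp only [hg]
  refine ⟨hF0, ?_, fun m => ?_⟩
  · have := hcoeff 0
    simp only [PowerSeries.coeff_zero_X_mul, hF0] at this
    norm_num at this
    linarith
  · have := hcoeff (m + 1)
    simp only [PowerSeries.coeff_succ_X_mul, PowerSeries.coeff_derivative] at this
    rcases m with _ | k
    · simp only [PowerSeries.coeff_zero_X_mul, hF0] at this ⊢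
      norm_num at this ⊢
      linarith
    · simp only [PowerSeries.coeff_succ_X_mul, PowerSeries.coeff_derivative] at this
      push_cast at this ⊢
      rw [show k + 1 + 1 + 1 = k + 1 + 2 by ring] at this
      linarith

/-- The positive factor matters: it shows that the normalising denominator `C_t^l(1)` in `Q` does
not vanish. -/
lemma gegenbauer_eq_zonal {n : ℕ} (hn : 2 ≤ n) (t : ℕ) :
    ∃ a : ℝ, 0 < a ∧ ∀ x, gegenbauer (((n : ℝ) - 2) / 2) t x = a * zonal n x 1 t := by
  rcases hn.eq_or_lt with rfl | hn'
  · exact ⟨1, one_pos, fun x => by simp [gegenbauer, chebyshev_eq_zonal]⟩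
  have hn3 : (2 : ℝ) < n := by exact_mod_cast hn'
  have hl : ((n : ℝ) - 2) / 2 ≠ 0 := by linarith
  -- `a t` is the value `C_t^l(1) = (2 l) (2 l + 1) ⋯ (2 l + t - 1) / t!`, with `2 l = n - 2`.
  let a : ℕ → ℝ := fun t => ∏ k ∈ Finset.range t, ((n : ℝ) - 2 + k) / (k + 1)
  have ha : ∀ m : ℕ, ((m : ℝ) + 1) * a (m + 1) = (n - 2 + m) * a m := fun m => by
    simp only [a, Finset.prod_range_succ]
    field_simp
  refine ⟨a t, Finset.prod_pos fun k _ => div_pos (by linarith [k.cast_nonneg (α := ℝ)]) (by positivity), fun x => ?_⟩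
  obtain ⟨g0, g1, g2⟩ := gegenbauer_recurrence hl x
  induction t using Nat.twoStepInduction with
  | zero => simp [g0, a, zonal]
  | one => simp [g1, a, zonal, mul_div_cancel₀]
  | more m h0 h1 =>
    have hm : (m : ℝ) + 2 ≠ 0 := by positivity
    apply mul_left_cancel₀ hm
    rw [g2, h0, h1]
    have r := zonal_recurrence hn x 1 m
    have a0 := ha m
    have a1 := ha (m + 1)
    push_cast at a1
    linear_combination (-zonal n x 1 (m + 2)) * a1 - a (m + 1) * r + zonal n x 1 m * a0

lemma Q_eq {n : ℕ} (hn : 2 ≤ n) (t : ℕ) (x : ℝ) : Q n t x = dimHarm n t * zonal n x 1 t := by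
  obtain ⟨a, ha, h⟩ := gegenbauer_eq_zonal hn t
  rw [Q, h, h, zonal_one_one hn]
  field_simp

lemma binom_natCast (a b : ℕ) : binom a b = a.choose b := by
  simp [binom, Ring.choose_natCast]

lemma dimHarm_pos {n t : ℕ} (hn : 2 ≤ n) (ht : 1 ≤ t) : 0 < dimHarm n t := by
  obtain ⟨k, rfl⟩ := Nat.exists_eq_add_of_le hn
  obtain ⟨s, rfl⟩ := Nat.exists_eq_add_of_le ht
  have e1 : (((2 + k : ℕ) : ℤ) + (1 + s : ℕ) - 1) = ((k + s + 2 : ℕ) : ℤ) := by push_cast; ring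
  rw [dimHarm, e1, binom_natCast]
  rcases s with _ | s
  · simp [binom]
    positivity
  · have e2 : (((2 + k : ℕ) : ℤ) + (1 + (s + 1) : ℕ) - 3) = ((k + s + 1 : ℕ) : ℤ) := by
      push_cast; ring
    have e3 : (((1 + (s + 1) : ℕ) : ℤ) - 2) = ((s : ℕ) : ℤ) := by push_cast; ring
    rw [e2, e3, binom_natCast, sub_pos]
    have h1 : (k + s + 1).choose s ≤ (k + s + 2).choose (s + 1) := by
      rw [Nat.choose_succ_succ]; exact Nat.le_add_right _ _
    have h2 : (k + (s + 1) + 2).choose (1 + (s + 1)) =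
        (k + s + 2).choose (s + 1) + (k + s + 2).choose (s + 2) := by
      rw [← Nat.choose_succ_succ]; congr 1; lia
    have h3 : 0 < (k + s + 2).choose (s + 2) := Nat.choose_pos (by lia)
    have : (k + s + 1).choose s < (k + (s + 1) + 2).choose (1 + (s + 1)) := by lia
    exact_mod_cast this

end Gegenbauer

/-! ### Designs of harmonic index -/

section Design

variable {n t : ℕ}

lemma isLeast_Q (hn : 2 ≤ n) (t : ℕ) : IsLeast (Q n t '' Set.Icc (-1) 1) (-c n t) := by
  have hQ : Continuous (Q n t) := by
    simp only [funext (Q_eq hn t)]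
    exact continuous_const.mul (continuous_zonal n t)
  rw [c, neg_neg]
  exact (isCompact_Icc.image hQ).isLeast_sInf ((Set.nonempty_Icc.2 (by norm_num)).image _)

/-- Testing the design condition on the zonal harmonic with pole `y`, and splitting off the
diagonal term `x = y`. -/
lemma IsDesign.sum_erase [DecidableEq (EuclideanSpace ℝ (Fin n))] (hn : 2 ≤ n)
    {X : Finset (EuclideanSpace ℝ (Fin n))} (hX : IsDesign t X)
    {y : EuclideanSpace ℝ (Fin n)} (hy : y ∈ X) :
    ∑ x ∈ X.erase y, Q n t (inner ℝ x y) = -dimHarm n t := by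
  have hnorm : ∀ x ∈ X, ‖x‖ = 1 := fun x hx => by simpa using hX.subset_sphere x hx
  have hy1 : ∑ i, y i ^ 2 = 1 := by
    rw [← EuclideanSpace.real_norm_sq_eq, hnorm y hy, one_pow]
  have h : ∑ x ∈ X, zonal n (inner ℝ x y : ℝ) 1 t = 0 := by
    rw [← hX.sum_eq_zero _ (isHarm_zonal hn hy1 t)]
    exact Finset.sum_congr rfl fun x hx => (eval_zonal (hnorm x hx) t).symm
  rw [← Finset.add_sum_erase _ _ hy, real_inner_self_eq_norm_sq, hnorm y hy, one_pow,
    zonal_one_one hn] at h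
  simp only [Q_eq hn, ← Finset.mul_sum]
  linear_combination dimHarm n t * h

lemma IsDesign.neg_c_le_Q (hn : 2 ≤ n) {X : Finset (EuclideanSpace ℝ (Fin n))}
    (hX : IsDesign t X) {x y : EuclideanSpace ℝ (Fin n)} (hx : x ∈ X) (hy : y ∈ X) :
    -c n t ≤ Q n t (inner ℝ x y) := by
  have hnorm : ∀ x ∈ X, ‖x‖ = 1 := fun x hx => by simpa using hX.subset_sphere x hx
  refine (isLeast_Q hn t).2 ⟨_, ?_, rfl⟩
  rw [Set.mem_Icc, ← abs_le]
  simpa [hnorm x hx, hnorm y hy] using abs_real_inner_le_norm x y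

end Design

end HarmonicIndex

end

theorem theorem2 (n t : ℕ) (hn : 2 ≤ n) (ht : 1 ≤ t)
    (X : Finset (EuclideanSpace ℝ (Fin n))) (hX : HarmonicIndex.IsDesign t X) :
    IsLeast (HarmonicIndex.Q n t '' Set.Icc (-1) 1) (-HarmonicIndex.c n t) ∧
      0 < HarmonicIndex.c n t ∧
      1 + 1 / HarmonicIndex.c n t *
          ((HarmonicIndex.binom ((n : ℤ) + t - 1) t : ℝ)
            - (HarmonicIndex.binom ((n : ℤ) + t - 3) ((t : ℤ) - 2) : ℝ)) ≤ (X.card : ℝ) ∧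
      ((X.card : ℝ) = 1 + 1 / HarmonicIndex.c n t *
          ((HarmonicIndex.binom ((n : ℤ) + t - 1) t : ℝ)
            - (HarmonicIndex.binom ((n : ℤ) + t - 3) ((t : ℤ) - 2) : ℝ)) ↔
        ∀ a ∈ HarmonicIndex.innerProducts X,
          HarmonicIndex.c n t = -HarmonicIndex.Q n t a) := by
  classical
  rw [← HarmonicIndex.dimHarm]
  have hd := HarmonicIndex.dimHarm_pos hn ht
  set d := HarmonicIndex.dimHarm n t
  set γ := HarmonicIndex.c n t
  obtain ⟨y₀, hy₀⟩ := hX.nonempty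
  -- If `γ ≤ 0`, then `Q ≥ 0` on `[-1, 1]`, while its values off the diagonal sum to `-d < 0`.
  have hγ : 0 < γ := by
    by_contra! h
    have := Finset.sum_nonneg fun x (hx : x ∈ X.erase y₀) =>
      (neg_nonneg.2 h).trans (hX.neg_c_le_Q hn (Finset.mem_of_mem_erase hx) hy₀)
    rw [hX.sum_erase hn hy₀] at this
    linarith
  -- The defect in the bound is a sum of nonnegative terms, one for each `x ≠ y`.
  have key : ∀ y ∈ X, ∑ x ∈ X.erase y, (HarmonicIndex.Q n t (inner ℝ x y) + γ) =
      γ * (X.card - (1 + 1 / γ * d)) := by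
    intro y hy
    have hcard : ((X.erase y).card : ℝ) = X.card - 1 := by
      rw [← Finset.card_erase_add_one hy]
      push_cast
      ring
    rw [Finset.sum_add_distrib, hX.sum_erase hn hy, Finset.sum_const, nsmul_eq_mul, hcard]
    field_simp
    ring
  have hnonneg : ∀ y ∈ X, ∀ x ∈ X.erase y, 0 ≤ HarmonicIndex.Q n t (inner ℝ x y) + γ := by
    intro y hy x hx
    linarith [hX.neg_c_le_Q hn (Finset.mem_of_mem_erase hx) hy]
  refine ⟨HarmonicIndex.isLeast_Q hn t, hγ, ?_, ?_, ?_⟩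
  · have := Finset.sum_nonneg (hnonneg y₀ hy₀)
    rw [key y₀ hy₀] at this
    exact sub_nonneg.1 (nonneg_of_mul_nonneg_right this hγ)
  · rintro h a ⟨x, hx, y, hy, hxy, rfl⟩
    have h0 := key y hy
    rw [h, sub_self, mul_zero, Finset.sum_eq_zero_iff_of_nonneg (hnonneg y hy)] at h0
    linarith [h0 x (Finset.mem_erase.2 ⟨hxy, hx⟩)]
  · intro h
    have h0 := key y₀ hy₀
    rw [Finset.sum_eq_zero fun x hx => ?_] at h0
    · rcases mul_eq_zero.1 h0.symm with h1 | h1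
      · exact absurd h1 hγ.ne'
      · linarith
    · have := h _ ⟨x, Finset.mem_of_mem_erase hx, y₀, hy₀, Finset.ne_of_mem_erase hx, rfl⟩
      linarith
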